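/- Let $F=\mathbb F_q$ be a finite field with $q$ elements and characteristic $p$. Let $T$ be a finite set of positive integers, $l_i\ge 0$ ($i\in T$) and $m\ge 0$ integers, and $\alpha\in F$. For a monic polynomial $f\in F[x]$ of degree $d$ put $\langle f\rangle = x^{d}f(1/x) \bmod x^{2}$; thus $\langle f\rangle = 1+f_1x \bmod x^2$, where $f_1$ is the coefficient of $x^{d-1}$ in $f$ (and $f_1=0$ if $d=0$). Let $I_i$ be the set of monic irreducible polynomials of degree $i$ over $F$. Let $N^*(m,\prod_{i\in T}I_i^{l_i},\langle x+\alpha\rangle)$ be the number of monic polynomials $g\in F[x]$ of degree $m$ with $\langle g\rangle=\langle x+\alpha\rangle$ which, for each $i\in T$, have exactly $l_i$ monic irreducible factors of degree $i$, counted with multiplicity. Write $[P]=1$ if $P$ holds and $[P]=0$ otherwise, $v(\alpha)=q[\alpha=0]-1$, let $\mu$ be the Möbius function, and $\binom{x}{n}=x(x-1)\cdots(x-n+1)/n!$ for rational $x$ and integers $n\ge0$. For $i\ge 1$ put $$a_i=\frac1{iq}\sum_{k\mid i,\;p\nmid k}\mu(k)q^{i/k},\qquad b_i=\frac1i\sum_{k\mid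 i,\;p\mid k}\mu(k)q^{i/k}.$$ For an integer $n\ge 0$ and rational $a,b$ with $b\ne 0$ put $$A_n(a,b)=\sum_{j=0}^{\lfloor n/p\rfloor}\binom{aq/p}{j}\binom{b}{n-pj}(-1)^{j+pj},\qquad B_n(a,b)=\sum_{j=0}^{\lfloor n/p\rfloor}\binom{aq/p+j-1}{j}\binom{b+n-pj-1}{n-pj},$$ and, for $b=0$, put $A_n(a,0)=\binom{aq/p}{n/p}(-1)^{n+n/p}$ and $B_n(a,0)=\binom{aq/p+n/p-1}{n/p}$ if $p\mid n$, and $A_n(a,0)=B_n(a,0)=0$ if $p\nmid n$. Then $$\begin{aligned}N^*\Big(m,\prod_{i\in T}I_i^{l_i},\langle x+\alpha\rangle\Big)={}&q^{m-1}\Big(\prod_{i\in T}\binom{|I_i|+l_i-1}{l_i}q^{-il_i}\Big)\sum_{(j_i)_{i\in T}}\Big[\sum_{i\in T}i(l_i+j_i)\le m\Big]\prod_{i\in T}\binom{|I_i|}{j_i}(-1)^{j_i}q^{-ij_i}\\&+\frac{v(\alpha)}q\Big(\prod_{i\in T}B_{l_i}(a_i,b_i)\Big)\sum_{(k_i)_{i\in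 T}}\Big[\sum_{i\in T}i(l_i+k_i)=m\Big]\prod_{i\in T}A_{k_i}(a_i,b_i)(-1)^{k_i},\end{aligned}$$ where $(j_i)$ runs over all integer tuples with $0\le j_i\le|I_i|$ and $(k_i)$ over all tuples of nonnegative integers (only finitely many of the latter contribute). -/

import Mathlib

namespace PrescribedFactorization

open Polynomial

noncomputable section

/-- The class `⟨f⟩_w = x ^ d(f) * f(1/x) mod x ^ (w + 1)`, as an element of `F[x] / (x ^ (w + 1))`. -/
def bracket {F : Type*} [Field F] (w : ℕ) (f : F[X]) :
    F[X] ⧸ Ideal.span {(X : F[X]) ^ (w + 1)} :=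
  Ideal.Quotient.mk _ f.reverse

/-- The set `I_i` of monic irreducible polynomials of degree `i`. -/
def irr (F : Type*) [Field F] (i : ℕ) : Set F[X] :=
  {f | f.Monic ∧ Irreducible f ∧ f.natDegree = i}

open Classical in
/-- The number of monic irreducible factors of degree `i` of a nonzero polynomial `f`,
counted with multiplicity. -/
def factorCount {F : Type*} [Field F] (i : ℕ) (f : F[X]) : ℕ :=
  ((UniqueFactorizationMonoid.normalizedFactors f).filter fun h => h.natDegree = i).card

/-- `N^*(m, ∏_{i ∈ T} I_i ^ {l_i}, ⟨f⟩_w)`: the number of monic polynomials `g` of degree `m` with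
`⟨g⟩_w = ⟨f⟩_w` that have exactly `l_i` monic irreducible factors of degree `i`, counted with
multiplicity, for every `i ∈ T`. -/
def NStar {F : Type*} [Field F] (w m : ℕ) (T : Finset ℕ) (l : ℕ → ℕ) (f : F[X]) : ℕ :=
  Set.ncard {g : F[X] | g.Monic ∧ g.natDegree = m ∧ bracket w g = bracket w f ∧
    ∀ i ∈ T, factorCount i g = l i}

/-- `a_i = (1 / (i q)) ∑_{k ∣ i, p ∤ k} μ(k) q ^ (i / k)`. -/
def aCoef (p q i : ℕ) : ℚ :=
  1 / ((i : ℚ) * q) *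
    ∑ k ∈ i.divisors with ¬ p ∣ k, (ArithmeticFunction.moebius k : ℚ) * (q : ℚ) ^ (i / k)

/-- `b_i = (1 / i) ∑_{k ∣ i, p ∣ k} μ(k) q ^ (i / k)`. -/
def bCoef (p q i : ℕ) : ℚ :=
  1 / (i : ℚ) *
    ∑ k ∈ i.divisors with p ∣ k, (ArithmeticFunction.moebius k : ℚ) * (q : ℚ) ^ (i / k)

/-- `A_m(a, b)`. Here `Ring.choose x n = x (x - 1) ⋯ (x - n + 1) / n!` is the binomial coefficient
with arbitrary rational upper entry (the numbers `b_i` may be negative). -/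
def A (p q m : ℕ) (a b : ℚ) : ℚ :=
  if b = 0 then
    if p ∣ m then Ring.choose (a * q / p) (m / p) * (-1) ^ (m + m / p) else 0
  else
    ∑ j ∈ Finset.range (m / p + 1),
      Ring.choose (a * q / p) j * Ring.choose b (m - p * j) * (-1) ^ (j + p * j)

/-- `B_m(a, b)`. -/
def B (p q m : ℕ) (a b : ℚ) : ℚ :=
  if b = 0 then
    if p ∣ m then Ring.choose (a * q / p + (m / p : ℕ) - 1) (m / p) else 0
  else
    ∑ j ∈ Finset.range (m / p + 1),
      Ring.choose (a * q / p + j - 1) j *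
        Ring.choose (b + (m - p * j : ℕ) - 1) (m - p * j)

open Classical in
/-- `v(α) = q [α = 0] - 1`. -/
def v {F : Type*} [Field F] (q : ℕ) (α : F) : ℚ :=
  (q : ℚ) * (if α = 0 then 1 else 0) - 1

end

end PrescribedFactorization

namespace PrescribedFactorization

open Polynomial

noncomputable section

/-! ### Weighted generating series with prescribed factor counts -/

section GeneratingSeries

open UniqueFactorizationMonoid
open scoped Classical

/-! For monic `g` the class of `g` mod `x^2` records only `g.nextCoeff`, which is additive under
products. So for an additive character `ψ` of `F` the weight `g ↦ ψ g.nextCoeff` is completely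
multiplicative, and orthogonality turns `q * NStar` into a sum over `a ∈ F` of coefficients of
generating series weighted by `ψ.mulShift a` (`card_mul_NStar`).

Each series is an Euler product. Prescribing `l i` factors of degree `i` multiplies the full series
by `c_i X^(i l_i) ∏ (1 - w(h) X^i)`, with `h` over `irrs F i` and `c_i` the `l i`-th coefficient of
`∏ 1/(1 - w(h) X)` (`genSeries_factorCount`). For `a = 0` the full series is `1/(1 - qX)`, which
gives the first term. For `a ≠ 0` it is `1`, which forces the total degree to equal `m` in the
second term.

For nontrivial `ψ` the local products come from the distribution of `nextCoeff` on `irrs F i`: each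
nonzero value occurs `a_i` times and `0` occurs `a_i + b_i` times, by counting traces in the
extension of degree `i` and Möbius inversion. As `ψ` takes each `p`-th root of unity `q/p` times, `∏
(1 - ψ(h.nextCoeff) X) = (1 - X)^(b_i) (1 - X^p)^(a_i q/p)`. Its coefficients are the `A` up to
sign, those of its inverse the `B`. Nothing here depends on `ψ`, so the sum of `ψ(-aα)` over `a ≠
0`, which is `v(α)`, factors out. -/

theorem finite_monic_natDegree_eq (F : Type*) [Field F] [Finite F] (n : ℕ) :
    {g : F[X] | g.Monic ∧ g.natDegree = n}.Finite := by
  have : Finite (degreeLT F n) := Finite.of_equiv _ (degreeLTEquiv F n).toEquiv.symm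
  exact Set.finite_coe_iff.1 (Finite.of_equiv _ (monicEquivDegreeLT n).symm)

/-- The finite set of monic polynomials of degree `n` over a finite field. -/
def monics (F : Type*) [Field F] [Finite F] (n : ℕ) : Finset F[X] :=
  (finite_monic_natDegree_eq F n).toFinset

variable {F : Type*} [Field F]

/-- The number of irreducible factors of `g` lying in `S`, counted with multiplicity. -/
def countIn (S : Set F[X]) (g : F[X]) : ℕ :=
  ((normalizedFactors g).filter (· ∈ S)).card

theorem countIn_mul (S : Set F[X]) {h g : F[X]} (hh : h.Monic) (hi : Irreducible h) (hg : g ≠ 0) :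
    countIn S (h * g) = countIn S g + if h ∈ S then 1 else 0 := by
  rw [countIn, normalizedFactors_mul hh.ne_zero hg, normalizedFactors_irreducible hi,
    hh.normalize_eq_self, Multiset.filter_add, Multiset.card_add, add_comm]
  congr 1
  split_ifs with hS <;> simp [Multiset.filter_singleton, hS]

theorem countIn_insert_of_not_dvd (S : Set F[X]) {h g : F[X]} (hg : ¬ h ∣ g) :
    countIn (insert h S) g = countIn S g := by
  unfold countIn
  refine congrArg _ ?_
  refine @Multiset.filter_congr _ _ _ (_) (_) _ fun x hx => ?_
  have : x ≠ h := by
    rintro rfl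
    exact hg (dvd_of_mem_normalizedFactors hx)
  simp [this]

theorem countIn_empty (g : F[X]) : countIn ∅ g = 0 := by
  simp [countIn]

variable [Finite F]

@[simp]
theorem mem_monics {n : ℕ} {g : F[X]} : g ∈ monics F n ↔ g.Monic ∧ g.natDegree = n := by
  simp [monics]

theorem card_monics (n : ℕ) : (monics F n).card = Nat.card F ^ n := by
  have h1 : Nat.card {g : F[X] // g.Monic ∧ g.natDegree = n} = Nat.card F ^ n := by
    rw [Nat.card_congr (monicEquivDegreeLT n), Nat.card_congr (degreeLTEquiv F n).toEquiv,
      Nat.card_fun, Nat.card_fin]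
  rw [← h1, monics, ← Set.ncard_eq_toFinset_card _ (finite_monic_natDegree_eq F n)]
  rfl

/-- A weight on polynomials that is completely multiplicative on monic polynomials. -/
structure IsWeight {R : Type*} [CommRing R] (w : F[X] → R) : Prop where
  mul : ∀ f g : F[X], f.Monic → g.Monic → w (f * g) = w f * w g

variable {R : Type*} [CommRing R]

/-- The generating series `∑ w(g) X ^ deg g` over the monic polynomials `g` with property `P`. -/
def genSeries (w : F[X] → R) (P : F[X] → Prop) : PowerSeries R :=
  PowerSeries.mk fun n => ∑ g ∈ monics F n with P g, w g

theorem coeff_genSeries (w : F[X] → R) (P : F[X] → Prop) (n : ℕ) :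
    PowerSeries.coeff n (genSeries w P) = ∑ g ∈ monics F n with P g, w g :=
  PowerSeries.coeff_mk _ _

theorem genSeries_congr (w : F[X] → R) {P Q : F[X] → Prop} (h : ∀ g : F[X], g.Monic → (P g ↔ Q g)) :
    genSeries w P = genSeries w Q := by
  ext n
  simp only [coeff_genSeries]
  refine Finset.sum_congr (Finset.filter_congr fun g hg => h g (mem_monics.1 hg).1) fun _ _ => rfl

theorem genSeries_add_not (w : F[X] → R) (P Q : F[X] → Prop) :
    genSeries w (fun g => Q g ∧ P g) + genSeries w (fun g => ¬ Q g ∧ P g) = genSeries w P := by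
  ext n
  simp only [map_add, coeff_genSeries]
  rw [← Finset.sum_filter_add_sum_filter_not ((monics F n).filter P) Q]
  simp only [Finset.filter_filter, and_comm]

theorem genSeries_dvd {w : F[X] → R} (hw : IsWeight w) (P : F[X] → Prop) {h : F[X]}
    (hh : h.Monic) :
    genSeries w (fun g => h ∣ g ∧ P g) =
      PowerSeries.C (w h) * PowerSeries.X ^ h.natDegree * genSeries w (fun g => P (h * g)) := by
  ext n
  rw [mul_assoc, PowerSeries.coeff_C_mul, PowerSeries.coeff_X_pow_mul', coeff_genSeries]
  split_ifs with hn
  · rw [coeff_genSeries, Finset.mul_sum]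
    symm
    refine Finset.sum_bij (fun g _ => h * g) ?_ ?_ ?_ ?_
    · intro g hg
      simp only [Finset.mem_filter, mem_monics] at hg ⊢
      refine ⟨⟨hh.mul hg.1.1, ?_⟩, dvd_mul_right _ _, hg.2⟩
      rw [hh.natDegree_mul hg.1.1, hg.1.2]
      omega
    · intro a _ b _ hab
      exact mul_left_cancel₀ hh.ne_zero hab
    · intro g hg
      simp only [Finset.mem_filter, mem_monics] at hg
      obtain ⟨⟨hm, hd⟩, ⟨k, rfl⟩, hP⟩ := hg
      have hk : k.Monic := hh.of_mul_monic_left hm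
      refine ⟨k, ?_, rfl⟩
      rw [hh.natDegree_mul hk] at hd
      simp only [Finset.mem_filter, mem_monics]
      exact ⟨⟨hk, by omega⟩, hP⟩
    · intro g hg
      simp only [Finset.mem_filter, mem_monics] at hg
      exact (hw.mul h g hh hg.1.1).symm
  · rw [mul_zero]
    refine Finset.sum_eq_zero fun g hg => ?_
    simp only [Finset.mem_filter, mem_monics] at hg
    exact absurd (hg.1.2 ▸ natDegree_le_of_dvd hg.2.1 hg.1.1.ne_zero) hn

/-- When `P` ignores the factor `h`, discarding the multiples of `h` removes exactly the Euler
factor of `h`. -/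
theorem genSeries_not_dvd {w : F[X] → R} (hw : IsWeight w) {P : F[X] → Prop} {h : F[X]}
    (hh : h.Monic) (hP : ∀ g : F[X], g.Monic → (P (h * g) ↔ P g)) :
    genSeries w (fun g => ¬ h ∣ g ∧ P g) =
      (1 - PowerSeries.C (w h) * PowerSeries.X ^ h.natDegree) * genSeries w P := by
  have h1 := genSeries_add_not w P (fun g => h ∣ g)
  rw [genSeries_dvd hw P hh, genSeries_congr w hP] at h1
  rw [sub_mul, one_mul, eq_sub_iff_add_eq, add_comm]
  exact h1

/-- Such a `g` is a product of `n` elements of `S`, with repetition, and a cofactor coprime to `S`.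
The first choice contributes the complete homogeneous symmetric function of the weights, the second
removes the Euler factors of `S`. -/
theorem genSeries_countIn_eq {w : F[X] → R} (hw : IsWeight w) (P : F[X] → Prop) (d : ℕ)
    (S : Finset F[X]) (hS : ∀ h ∈ S, h.Monic ∧ Irreducible h ∧ h.natDegree = d)
    (hP : ∀ h ∈ S, ∀ g : F[X], g.Monic → (P (h * g) ↔ P g)) (n : ℕ) :
    genSeries w (fun g => countIn S g = n ∧ P g) =
      PowerSeries.C (PowerSeries.coeff n (∏ h ∈ S, PowerSeries.mk fun k => w h ^ k)) *
        PowerSeries.X ^ (d * n) *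
        (∏ h ∈ S, (1 - PowerSeries.C (w h) * PowerSeries.X ^ d)) * genSeries w P := by
  induction S using Finset.induction_on generalizing n with
  | empty =>
    rcases Nat.eq_zero_or_pos n with rfl | hn
    · simp [countIn_empty]
    · have : ∀ g : F[X], g.Monic → ((countIn (∅ : Set F[X]) g = n ∧ P g) ↔ False) := by
        intro g _
        simp only [countIn_empty, iff_false, not_and]
        omega
      rw [Finset.coe_empty, genSeries_congr w this]
      ext k
      simp [coeff_genSeries, PowerSeries.coeff_one, hn.ne']
  | insert h S hhS ih =>
    obtain ⟨hm, hirr, hd⟩ := hS h (Finset.mem_insert_self _ _)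
    have ih' := ih (fun k hk => hS k (Finset.mem_insert_of_mem hk))
      (fun k hk => hP k (Finset.mem_insert_of_mem hk))
    have hPh := hP h (Finset.mem_insert_self _ _)
    have key : ∀ n, genSeries w (fun g => ¬ h ∣ g ∧ countIn (insert h S : Finset F[X]) g = n ∧ P g) =
        (1 - PowerSeries.C (w h) * PowerSeries.X ^ d) *
          genSeries w (fun g => countIn S g = n ∧ P g) := by
      intro n
      rw [← hd, ← genSeries_not_dvd hw hm]
      · refine genSeries_congr w fun g _ => and_congr_right fun hg => ?_
        rw [Finset.coe_insert, countIn_insert_of_not_dvd _ hg]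
      · intro g hg
        rw [countIn_mul _ hm hirr hg.ne_zero, hPh g hg]
        simp [hhS]
    -- Splitting on `h ∣ g` and dividing by `h` lowers the count by one: this is the recurrence for
    -- complete homogeneous symmetric functions.
    induction n with
    | zero =>
      rw [← genSeries_add_not w _ (fun g => h ∣ g), key, ih', genSeries_dvd hw _ hm]
      have : ∀ g : F[X], g.Monic →
          ((countIn (insert h S : Finset F[X]) (h * g) = 0 ∧ P (h * g)) ↔ False) := by
        intro g hg
        rw [countIn_mul _ hm hirr hg.ne_zero]
        simp
      rw [genSeries_congr w this]
      have h0 : genSeries w (fun _ : F[X] => False) = 0 := by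
        ext k
        simp [coeff_genSeries]
      rw [h0, Finset.prod_insert hhS, Finset.prod_insert hhS]
      simp only [PowerSeries.coeff_zero_eq_constantCoeff, map_mul, map_prod]
      rw [← PowerSeries.coeff_zero_eq_constantCoeff_apply (PowerSeries.mk fun k => w h ^ k)]
      simp only [PowerSeries.coeff_mk]
      simp
      ring
    | succ n ihn =>
      rw [← genSeries_add_not w _ (fun g => h ∣ g), key, ih', genSeries_dvd hw _ hm, hd]
      have : ∀ g : F[X], g.Monic →
          ((countIn (insert h S : Finset F[X]) (h * g) = n + 1 ∧ P (h * g)) ↔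
            countIn (insert h S : Finset F[X]) g = n ∧ P g) := by
        intro g hg
        rw [countIn_mul _ hm hirr hg.ne_zero, hPh g hg]
        simp
      rw [genSeries_congr w this, ihn, Finset.prod_insert hhS, Finset.prod_insert hhS]
      have hgeom : (PowerSeries.mk fun k => w h ^ k) =
          1 + PowerSeries.C (w h) * (PowerSeries.X * PowerSeries.mk fun k => w h ^ k) := by
        ext k
        rcases k with _ | k
        · simp
        · simp [PowerSeries.coeff_one, PowerSeries.coeff_succ_X_mul, pow_succ']
      have hc : PowerSeries.coeff (n + 1)
          ((PowerSeries.mk fun k => w h ^ k) * ∏ x ∈ S, PowerSeries.mk fun k => w x ^ k) =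
          PowerSeries.coeff (n + 1) (∏ x ∈ S, PowerSeries.mk fun k => w x ^ k) +
          w h * PowerSeries.coeff n
          ((PowerSeries.mk fun k => w h ^ k) * ∏ x ∈ S, PowerSeries.mk fun k => w x ^ k) := by
        conv_lhs => rw [hgeom]
        rw [add_mul, one_mul, map_add, mul_assoc, mul_assoc, PowerSeries.coeff_C_mul,
          PowerSeries.coeff_succ_X_mul]
      rw [hc]
      simp only [map_add, map_mul]
      ring

theorem finite_irr (i : ℕ) : (irr F i).Finite :=
  (finite_monic_natDegree_eq F i).subset fun _ hf => ⟨hf.1, hf.2.2⟩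

/-- The finite set of monic irreducible polynomials of degree `i` over a finite field. -/
def irrs (F : Type*) [Field F] [Finite F] (i : ℕ) : Finset F[X] :=
  (finite_irr (F := F) i).toFinset

theorem mem_irrs {i : ℕ} {f : F[X]} :
    f ∈ irrs F i ↔ f.Monic ∧ Irreducible f ∧ f.natDegree = i := by
  simp [irrs, irr]

theorem ncard_irr (i : ℕ) : (irr F i).ncard = (irrs F i).card :=
  Set.ncard_eq_toFinset_card _ _

theorem factorCount_eq_countIn (i : ℕ) (g : F[X]) :
    factorCount i g = countIn (irrs F i) g := by
  unfold factorCount countIn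
  refine congrArg _ ?_
  refine @Multiset.filter_congr _ _ _ (_) (_) _ fun x hx => ?_
  have hx0 := (irreducible_of_normalized_factor x hx)
  have hxm : x.Monic := by
    have := normalize_normalized_factor x hx
    rw [← this]
    exact Polynomial.monic_normalize hx0.ne_zero
  simp [mem_irrs, hx0, hxm]

theorem genSeries_factorCount {w : F[X] → R} (hw : IsWeight w) (T : Finset ℕ) (l : ℕ → ℕ) :
    genSeries w (fun g => ∀ i ∈ T, factorCount i g = l i) =
      (∏ i ∈ T, PowerSeries.C (PowerSeries.coeff (l i)
          (∏ h ∈ irrs F i, PowerSeries.mk fun k => w h ^ k)) *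
        PowerSeries.X ^ (i * l i) *
        ∏ h ∈ irrs F i, (1 - PowerSeries.C (w h) * PowerSeries.X ^ i)) *
      genSeries w fun _ => True := by
  induction T using Finset.induction_on with
  | empty => simp
  | insert i T hi ih =>
    rw [Finset.prod_insert hi, mul_assoc, ← ih,
      ← genSeries_countIn_eq hw _ i (irrs F i) (fun h hh => mem_irrs.1 hh)]
    · refine genSeries_congr w fun g _ => ?_
      rw [Finset.forall_mem_insert, factorCount_eq_countIn]
    · intro h hh g hg
      have hh' := mem_irrs.1 hh
      refine forall₂_congr fun j hj => ?_
      have : h ∉ irrs F j := by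
        rw [mem_irrs]
        rintro ⟨_, _, h3⟩
        exact hi (by rw [← hh'.2.2, h3]; exact hj)
      rw [factorCount_eq_countIn, factorCount_eq_countIn, countIn_mul _ hh'.1 hh'.2.1 hg.ne_zero]
      simp [this]

/-- The polynomial whose coefficients are those of the power series `∏ (1 - w(h) X)`. -/
theorem exists_polynomial_prod_one_sub {ι : Type*} (S : Finset ι) (w : ι → R) :
    ∃ Q : R[X], Q = ∏ h ∈ S, (1 - C (w h) * X) ∧ Q.natDegree < S.card + 1 ∧
      ∏ h ∈ S, (1 - PowerSeries.C (w h) * PowerSeries.X) = (Q : PowerSeries R) := by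
  refine ⟨_, rfl, ?_, ?_⟩
  · refine Nat.lt_succ_of_le ((natDegree_prod_le _ _).trans ?_)
    refine (Finset.sum_le_card_nsmul _ _ 1 fun h _ => ?_).trans (by simp)
    compute_degree
  · rw [← Polynomial.coeToPowerSeries.ringHom_apply, map_prod]
    simp

theorem coeff_prod_one_sub_of_card_lt {ι : Type*} {S : Finset ι} {w : ι → R} {k : ℕ}
    (hk : S.card < k) :
    PowerSeries.coeff k (∏ h ∈ S, (1 - PowerSeries.C (w h) * PowerSeries.X)) = 0 := by
  obtain ⟨Q, -, hdeg, hcoe⟩ := exists_polynomial_prod_one_sub S w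
  rw [hcoe, Polynomial.coeff_coe]
  exact coeff_eq_zero_of_natDegree_lt (by omega)

theorem coeff_genSeries_factorCount {w : F[X] → R} (hw : IsWeight w) (T : Finset ℕ) (l : ℕ → ℕ)
    (m : ℕ) :
    PowerSeries.coeff m (genSeries w (fun g => ∀ i ∈ T, factorCount i g = l i)) =
      (∏ i ∈ T, PowerSeries.coeff (l i) (∏ h ∈ irrs F i, PowerSeries.mk fun k => w h ^ k)) *
      ∑ j ∈ Fintype.piFinset (fun i : T => Finset.range ((irrs F i).card + 1)),
        if ∑ i : T, (i : ℕ) * (l i + j i) ≤ m then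
          (∏ i : T, PowerSeries.coeff (j i)
            (∏ h ∈ irrs F i, (1 - PowerSeries.C (w h) * PowerSeries.X))) *
          PowerSeries.coeff (m - ∑ i : T, (i : ℕ) * (l i + j i)) (genSeries w fun _ => True)
        else 0 := by
  have hexp : ∀ i : ℕ, ∏ h ∈ irrs F i, (1 - PowerSeries.C (w h) * PowerSeries.X ^ i) =
      ∑ j ∈ Finset.range ((irrs F i).card + 1), PowerSeries.C (PowerSeries.coeff j
        (∏ h ∈ irrs F i, (1 - PowerSeries.C (w h) * PowerSeries.X))) * PowerSeries.X ^ (i * j) := by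
    intro i
    obtain ⟨Q, hQ, hdeg, hcoe⟩ := exists_polynomial_prod_one_sub (irrs F i) w
    -- The polynomial `Q = ∏ (1 - w(h) X)` evaluated at `X ^ i`; its degree bound makes the
    -- expansion a finite sum over `range (card + 1)`.
    have hev : ∏ h ∈ irrs F i, (1 - PowerSeries.C (w h) * PowerSeries.X ^ i) =
        Q.eval₂ PowerSeries.C (PowerSeries.X ^ i) := by
      rw [hQ, eval₂_finsetProd]
      simp
    rw [hev, eval₂_eq_sum_range' _ hdeg, hcoe]
    simp [pow_mul]
  rw [genSeries_factorCount hw]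
  simp_rw [hexp]
  rw [Finset.prod_mul_distrib, Finset.prod_mul_distrib,
    ← Finset.prod_coe_sort T (fun i => ∑ j ∈ Finset.range ((irrs F i).card + 1), _),
    Finset.prod_univ_sum, ← map_prod, mul_assoc, mul_assoc, PowerSeries.coeff_C_mul]
  congr 1
  rw [Finset.prod_pow_eq_pow_sum, Finset.sum_mul, Finset.mul_sum, map_sum]
  refine Finset.sum_congr rfl fun j _ => ?_
  rw [Finset.prod_mul_distrib, Finset.prod_pow_eq_pow_sum, ← map_prod,
    ← Finset.sum_coe_sort T fun i => i * l i]
  have : ∀ a b : ℕ, ∀ c : R, ∀ L : PowerSeries R,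
      PowerSeries.X ^ a * (PowerSeries.C c * PowerSeries.X ^ b * L) =
        PowerSeries.C c * (PowerSeries.X ^ (a + b) * L) := by
    intros
    ring
  rw [this, PowerSeries.coeff_C_mul, PowerSeries.coeff_X_pow_mul', ← Finset.sum_add_distrib]
  simp_rw [← mul_add]
  split_ifs <;> simp

end GeneratingSeries

/-! ### Irreducible polynomials of given degree and next coefficient -/

section IrreducibleCount

open scoped Classical

variable {F : Type*} [Field F]

theorem trace_eq_div_mul_nextCoeff {K : Type*} [Field K] [Algebra F K] [FiniteDimensional F K]
    {n : ℕ} (hn : Module.finrank F K = n) (x : K) :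
    Algebra.trace F K x = -((n / (minpoly F x).natDegree : ℕ) * (minpoly F x).nextCoeff) := by
  rw [trace_eq_finrank_mul_minpoly_nextCoeff, mul_neg, ← hn,
    ← Module.finrank_mul_finrank F (IntermediateField.adjoin F {x}) K,
    IntermediateField.adjoin.finrank (Algebra.IsIntegral.isIntegral x),
    Nat.mul_div_cancel_left _ (minpoly.natDegree_pos (Algebra.IsIntegral.isIntegral x))]

variable [Finite F]

theorem minpoly_mem_irrs {K : Type*} [Field K] [Algebra F K] [FiniteDimensional F K] (x : K) :
    minpoly F x ∈ irrs F (minpoly F x).natDegree :=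
  mem_irrs.2 ⟨minpoly.monic (Algebra.IsIntegral.isIntegral x),
    minpoly.irreducible (Algebra.IsIntegral.isIntegral x), rfl⟩

theorem card_minpoly_eq {K : Type*} [Field K] [Fintype K] [Algebra F K]
    {n d : ℕ} (hn : Module.finrank F K = n) (hd : d ∣ n) {h : F[X]} (hh : h ∈ irrs F d) :
    (Finset.univ.filter fun x : K => minpoly F x = h).card = d := by
  obtain ⟨hm, hi, hdeg⟩ := mem_irrs.1 hh
  have hfd : FiniteDimensional F K := Module.Finite.of_finite
  have hn0 : n ≠ 0 := hn ▸ Module.finrank_pos.ne'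
  have hcard : Nat.card K = Nat.card F ^ n := by rw [Module.natCard_eq_pow_finrank (K := F), hn]
  have hroots : (Finset.univ.filter fun x : K => minpoly F x = h) = (h.rootSet K).toFinset := by
    ext x
    rw [Finset.mem_filter, Set.mem_toFinset, mem_rootSet, and_iff_right (Finset.mem_univ _),
      and_iff_right hm.ne_zero]
    constructor
    · rintro rfl
      exact minpoly.aeval F x
    · exact fun hx => (minpoly.eq_of_irreducible_of_monic hi hx hm).symm
  have hsplit : Splits (h.map (algebraMap F K)) := by
    have hdvd := hi.natDegree_dvd_iff_dvd_X_pow_card_pow_sub_X.1 (hdeg ▸ hd)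
    rw [← hcard, ← Fintype.card_eq_nat_card] at hdvd
    refine Splits.of_dvd ?_ ?_ (map_dvd (algebraMap F K) hdvd)
    · exact (FiniteField.isSplittingField_sub K F).splits
    · exact (Polynomial.map_ne_zero_iff (algebraMap F K).injective).2
        (FiniteField.X_pow_card_sub_X_ne_zero F Fintype.one_lt_card)
  rw [hroots, Set.toFinset_card, card_rootSet_eq_natDegree (PerfectField.separable_of_irreducible hi)
    hsplit, hdeg]

/-- Both sides count the elements of trace `-c` in the extension of degree `n`, the left one by
grouping them according to minimal polynomial. -/
theorem sum_divisors_mul_card_irrs_nextCoeff {n : ℕ} (hn : 0 < n) (c : F) :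
    ∑ d ∈ n.divisors, d * ((irrs F d).filter fun h => (n / d : ℕ) * h.nextCoeff = c).card =
      Nat.card F ^ (n - 1) := by
  obtain ⟨p, hp⟩ := CharP.exists F
  have hpp : Fact p.Prime := ⟨CharP.char_is_prime F p⟩
  have : NeZero n := ⟨hn.ne'⟩
  let K := FiniteField.Extension F p n
  let : Fintype K := Fintype.ofFinite K
  let : Fintype F := Fintype.ofFinite F
  have hrank : Module.finrank F K = n := FiniteField.finrank_extension F p n
  have hcard : Nat.card K = Nat.card F ^ n := FiniteField.natCard_extension F p n
  have hsurj : Function.Surjective (Algebra.trace F K) := Algebra.trace_surjective F K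
  have hfib : (Finset.univ.filter fun x : K => Algebra.trace F K x = -c).card =
      Nat.card F ^ (n - 1) := by
    -- The trace is additive and surjective, so all its fibres have the same size.
    have h1 : ∀ b : F, (Finset.univ.filter fun x : K => Algebra.trace F K x = b).card =
        (Finset.univ.filter fun x : K => Algebra.trace F K x = -c).card := by
      intro b
      exact AddMonoidHom.card_fiber_eq_of_mem_range (Algebra.trace F K).toAddMonoidHom
        (hsurj b) (hsurj (-c))
    have h2 := Finset.card_eq_sum_card_fiberwise (s := (Finset.univ : Finset K))
      (t := (Finset.univ : Finset F)) (f := Algebra.trace F K) (fun _ _ => Finset.mem_univ _)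
    rw [Finset.sum_congr rfl fun b _ => h1 b, Finset.sum_const, smul_eq_mul, Finset.card_univ,
      Finset.card_univ, Fintype.card_eq_nat_card, Fintype.card_eq_nat_card, hcard] at h2
    obtain ⟨k, rfl⟩ := Nat.exists_eq_succ_of_ne_zero hn.ne'
    rw [pow_succ'] at h2
    exact (Nat.eq_of_mul_eq_mul_left Nat.card_pos h2).symm
  rw [← hfib]
  symm
  rw [Finset.card_eq_sum_card_fiberwise (t := n.divisors)
    (f := fun x : K => (minpoly F x).natDegree)]
  · refine Finset.sum_congr rfl fun d hd => ?_
    have hd' := Nat.dvd_of_mem_divisors hd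
    rw [Finset.card_eq_sum_card_fiberwise (f := fun x : K => minpoly F x)
      (t := (irrs F d).filter fun h => (n / d : ℕ) * h.nextCoeff = c)]
    · rw [mul_comm, ← smul_eq_mul]
      refine Finset.sum_eq_card_nsmul fun h hh => ?_
      rw [Finset.mem_filter] at hh
      rw [Finset.filter_filter, Finset.filter_filter]
      refine Eq.trans (congrArg _ (Finset.filter_congr fun x _ => ?_))
        (card_minpoly_eq hrank hd' hh.1)
      constructor
      · exact fun hx => hx.2.2
      · rintro rfl
        have hdx := (mem_irrs.1 hh.1).2.2
        refine ⟨?_, hdx, rfl⟩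
        rw [trace_eq_div_mul_nextCoeff hrank, hdx, hh.2]
    · intro x hx
      simp only [Finset.coe_filter, Finset.mem_filter, Finset.mem_univ, true_and,
        Set.mem_ofPred_eq] at hx ⊢
      obtain ⟨hx1, rfl⟩ := hx
      rw [trace_eq_div_mul_nextCoeff hrank, neg_inj] at hx1
      exact ⟨minpoly_mem_irrs x, hx1⟩
  · intro x _
    have hdvd := minpoly.degree_dvd (K := F) (Algebra.IsIntegral.isIntegral x)
    rw [hrank] at hdvd
    exact Finset.mem_coe.2 (Nat.mem_divisors.2 ⟨hdvd, hn.ne'⟩)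

theorem sum_divisors_mul_card_irrs {n : ℕ} (hn : 0 < n) :
    ∑ d ∈ n.divisors, d * (irrs F d).card = Nat.card F ^ n := by
  let : Fintype F := Fintype.ofFinite F
  have h1 : ∑ c : F, ∑ d ∈ n.divisors,
      d * ((irrs F d).filter fun h => (n / d : ℕ) * h.nextCoeff = c).card =
      ∑ _c : F, Nat.card F ^ (n - 1) :=
    Finset.sum_congr rfl fun c _ => sum_divisors_mul_card_irrs_nextCoeff hn c
  rw [Finset.sum_comm, Finset.sum_const, smul_eq_mul, Finset.card_univ, Fintype.card_eq_nat_card,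
    ← pow_succ', Nat.sub_add_cancel hn] at h1
  rw [← h1]
  refine Finset.sum_congr rfl fun d _ => ?_
  rw [← Finset.mul_sum]
  exact congrArg (d * ·) (Finset.card_eq_sum_card_fiberwise
    (f := fun h : F[X] => (n / d : ℕ) * h.nextCoeff) fun _ _ => Finset.mem_univ _)

theorem mul_card_irrs_eq_sum_moebius {n : ℕ} (hn : 0 < n) :
    (n : ℚ) * (irrs F n).card =
      ∑ k ∈ n.divisors, (ArithmeticFunction.moebius k : ℚ) * (Nat.card F : ℚ) ^ (n / k) := by
  have h := (ArithmeticFunction.sum_eq_iff_sum_mul_moebius_eq (R := ℚ)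
    (f := fun d => (d : ℚ) * (irrs F d).card) (g := fun n => (Nat.card F : ℚ) ^ n)).1
    (fun n hn => by exact_mod_cast sum_divisors_mul_card_irrs (F := F) hn) n hn
  rw [← h, Nat.sum_divisorsAntidiagonal fun k j =>
    (ArithmeticFunction.moebius k : ℚ) * (Nat.card F : ℚ) ^ j]

theorem card_irrs_eq {p q : ℕ} (hq : Nat.card F = q) {i : ℕ} (hi : 0 < i) :
    ((irrs F i).card : ℚ) = q * aCoef p q i + bCoef p q i := by
  have hq0 : (q : ℚ) ≠ 0 := by
    rw [← hq]
    exact_mod_cast Nat.card_pos.ne'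
  have hi0 : (i : ℚ) ≠ 0 := by exact_mod_cast hi.ne'
  have h := mul_card_irrs_eq_sum_moebius (F := F) hi
  rw [hq, ← Finset.sum_filter_add_sum_filter_not _ fun k => p ∣ k] at h
  rw [aCoef, bCoef]
  field_simp
  linarith

/-- The Möbius function restricted to integers prime to `p` is the Dirichlet inverse of their
indicator, because that indicator is completely multiplicative. -/
theorem sum_divisors_mul_aCoef {p q : ℕ} (hp : p.Prime) (hq : q ≠ 0) {n : ℕ} (hn : 0 < n) :
    ∑ d ∈ n.divisors with ¬ p ∣ n / d, (d : ℚ) * aCoef p q d = (q : ℚ) ^ (n - 1) := by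
  have hq0 : (q : ℚ) ≠ 0 := by exact_mod_cast hq
  let χ : ArithmeticFunction ℚ := ⟨fun k => if k = 0 ∨ p ∣ k then 0 else 1, by simp⟩
  let M : ArithmeticFunction ℚ :=
    ⟨fun k => if p ∣ k then 0 else (ArithmeticFunction.moebius k : ℚ), by simp⟩
  let G : ArithmeticFunction ℚ := ⟨fun k => if k = 0 then 0 else (q : ℚ) ^ k, by simp⟩
  have hχM : χ * M = 1 := by
    ext k
    rcases Nat.eq_zero_or_pos k with rfl | hk
    · simp
    have h1 := congrArg (fun f => f k)
      (ArithmeticFunction.coe_moebius_mul_coe_zeta (R := ℚ))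
    rw [mul_comm] at h1
    simp only [ArithmeticFunction.mul_apply] at h1 ⊢
    by_cases hpk : p ∣ k
    · rw [Finset.sum_eq_zero]
      · rw [ArithmeticFunction.one_apply_ne]
        rintro rfl
        exact hp.one_lt.ne' (Nat.dvd_one.1 hpk)
      · intro x hx
        have hx' := Nat.mem_divisorsAntidiagonal.1 hx
        rw [← hx'.1, hp.dvd_mul] at hpk
        rcases hpk with h | h <;> simp [χ, M, h]
    · rw [← h1]
      refine Finset.sum_congr rfl fun x hx => ?_
      have hx' := Nat.mem_divisorsAntidiagonal.1 hx
      have h2 : ¬ p ∣ x.1 := fun h => hpk (hx'.1 ▸ h.mul_right _)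
      have h3 : ¬ p ∣ x.2 := fun h => hpk (hx'.1 ▸ h.mul_left _)
      have h4 : x.1 ≠ 0 := by
        rintro h
        exact h2 (h ▸ dvd_zero _)
      simp [χ, M, h2, h3, h4]
  have hMG : ∀ d, 0 < d → (M * G) d = q * (d * aCoef p q d) := by
    intro d hd
    have hd0 : (d : ℚ) ≠ 0 := by exact_mod_cast hd.ne'
    rw [ArithmeticFunction.mul_apply, Nat.sum_divisorsAntidiagonal fun a b => M a * G b, aCoef,
      Finset.sum_filter]
    have : (q : ℚ) * (d * (1 / (d * q) * ∑ a ∈ d.divisors,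
        if ¬ p ∣ a then (ArithmeticFunction.moebius a : ℚ) * (q : ℚ) ^ (d / a) else 0)) =
        ∑ a ∈ d.divisors,
        if ¬ p ∣ a then (ArithmeticFunction.moebius a : ℚ) * (q : ℚ) ^ (d / a) else 0 := by
      field_simp
    rw [this]
    refine Finset.sum_congr rfl fun a ha => ?_
    have : d / a ≠ 0 := (Nat.div_pos (Nat.divisor_le ha) (Nat.pos_of_mem_divisors ha)).ne'
    by_cases hpa : p ∣ a <;> simp [M, G, hpa, this]
  have h := congrArg (fun f => f n) (show χ * (M * G) = G by rw [← mul_assoc, hχM, one_mul])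
  rw [ArithmeticFunction.mul_apply (f := χ)] at h
  rw [Nat.sum_divisorsAntidiagonal' fun a b => χ a * (M * G) b] at h
  have hG : G n = q * (q : ℚ) ^ (n - 1) := by
    rw [← pow_succ', Nat.sub_add_cancel hn]
    simp [G, hn.ne']
  rw [hG] at h
  refine mul_left_cancel₀ hq0 ?_
  rw [← h, Finset.mul_sum, Finset.sum_filter]
  refine Finset.sum_congr rfl fun d hd => ?_
  have hd0 := Nat.pos_of_mem_divisors hd
  have : n / d ≠ 0 := (Nat.div_pos (Nat.divisor_le hd) hd0).ne'
  rw [hMG d hd0]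
  by_cases hpd : p ∣ n / d <;> simp [χ, hpd, this]

/-- Both families satisfy the same recursion over the divisors of `i`, so strong induction
identifies them. -/
theorem card_irrs_nextCoeff_of_ne_zero {p q : ℕ} [CharP F p] (hq : Nat.card F = q) {i : ℕ}
    (hi : 0 < i) {c : F} (hc : c ≠ 0) :
    (((irrs F i).filter fun h => h.nextCoeff = c).card : ℚ) = aCoef p q i := by
  have hp : p.Prime := CharP.char_is_prime F p
  have hq0 : q ≠ 0 := hq ▸ Nat.card_pos.ne'
  induction i using Nat.strong_induction_on generalizing c with
  | _ i ih =>
  have hi0 : (i : ℚ) ≠ 0 := by exact_mod_cast hi.ne'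
  have h1 : ∑ d ∈ i.divisors,
      (d : ℚ) * ((irrs F d).filter fun h => (i / d : ℕ) * h.nextCoeff = c).card =
      (q : ℚ) ^ (i - 1) := by
    rw [← hq]
    exact_mod_cast sum_divisors_mul_card_irrs_nextCoeff hi c
  rw [← sum_divisors_mul_aCoef hp hq0 hi, Finset.sum_filter,
    ← Nat.insert_self_properDivisors hi.ne', Finset.sum_insert Nat.self_notMem_properDivisors,
    Finset.sum_insert Nat.self_notMem_properDivisors] at h1
  have h2 : ∑ d ∈ i.properDivisors,
      (d : ℚ) * ((irrs F d).filter fun h => (i / d : ℕ) * h.nextCoeff = c).card =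
      ∑ d ∈ i.properDivisors, if ¬ p ∣ i / d then (d : ℚ) * aCoef p q d else 0 := by
    refine Finset.sum_congr rfl fun d hd => ?_
    have hd' := Nat.mem_properDivisors.1 hd
    have hd0 : 0 < d := Nat.pos_of_dvd_of_pos hd'.1 hi
    -- If `p ∣ i / d`, the condition reads `0 = c` and no `h` qualifies; otherwise `i / d` is a unit
    -- of `F` and only rescales `c` to another nonzero value.
    by_cases hpd : p ∣ i / d
    · have hu : ((i / d : ℕ) : F) = 0 := (CharP.cast_eq_zero_iff F p _).2 hpd
      rw [if_neg (not_not.2 hpd), Finset.filter_false_of_mem]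
      · simp
      · intro h _
        rw [hu, zero_mul]
        exact hc.symm
    · have hu : ((i / d : ℕ) : F) ≠ 0 := fun h => hpd ((CharP.cast_eq_zero_iff F p _).1 h)
      rw [if_pos hpd,
        ← ih d hd'.2 hd0 (c := ((i / d : ℕ) : F)⁻¹ * c) (mul_ne_zero (inv_ne_zero hu) hc)]
      congr 3
      refine Finset.filter_congr fun h _ => ?_
      rw [eq_inv_mul_iff_mul_eq₀ hu]
  rw [h2, add_left_inj, Nat.div_self hi, if_pos (Nat.dvd_one.not.2 hp.one_lt.ne')] at h1
  simpa using mul_left_cancel₀ hi0 h1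

theorem card_irrs_nextCoeff_zero {p q : ℕ} [CharP F p] (hq : Nat.card F = q) {i : ℕ}
    (hi : 0 < i) :
    (((irrs F i).filter fun h => h.nextCoeff = 0).card : ℚ) = aCoef p q i + bCoef p q i := by
  let : Fintype F := Fintype.ofFinite F
  have h := card_irrs_eq (F := F) (p := p) hq hi
  rw [Finset.card_eq_sum_card_fiberwise (f := nextCoeff) (t := Finset.univ)
    fun _ _ => Finset.mem_univ _, Nat.cast_sum, ← Finset.add_sum_erase _ _ (Finset.mem_univ 0),
    Finset.sum_congr rfl fun c hc =>
      card_irrs_nextCoeff_of_ne_zero (p := p) hq hi (Finset.ne_of_mem_erase hc),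
    Finset.sum_const, Finset.card_erase_of_mem (Finset.mem_univ _), Finset.card_univ,
    Fintype.card_eq_nat_card, hq, nsmul_eq_mul, Nat.cast_sub (hq ▸ Nat.card_pos)] at h
  push_cast at h
  linarith

end IrreducibleCount

/-! ### Rational powers of `1 - X` and the coefficients `A`, `B` -/

section OneSubPow

open PowerSeries in
/-- The power series `(1 - X) ^ r` for a rational exponent `r`. -/
def oneSubPow (r : ℚ) : ℚ⟦X⟧ :=
  rescale (-1) (binomialSeries ℚ r)

theorem coeff_oneSubPow (r : ℚ) (n : ℕ) :
    PowerSeries.coeff n (oneSubPow r) = (-1) ^ n * Ring.choose r n := by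
  simp [oneSubPow]

theorem coeff_oneSubPow_neg (r : ℚ) (n : ℕ) :
    PowerSeries.coeff n (oneSubPow (-r)) = Ring.choose (r + n - 1) n := by
  rw [coeff_oneSubPow, Ring.choose_neg, Units.smul_def, zsmul_eq_mul, ← mul_assoc]
  have : ((-1 : ℚ) ^ n * ((Int.negOnePow n : ℤ) : ℚ)) = 1 := by
    rw [Int.negOnePow_def]
    simp [← mul_pow]
  rw [this, one_mul]

theorem oneSubPow_add (r s : ℚ) : oneSubPow (r + s) = oneSubPow r * oneSubPow s := by
  simp [oneSubPow]

theorem oneSubPow_natCast (n : ℕ) : oneSubPow n = (1 - PowerSeries.X) ^ n := by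
  simp [oneSubPow, sub_eq_add_neg, PowerSeries.rescale_X]

theorem oneSubPow_mul_neg (r : ℚ) : oneSubPow r * oneSubPow (-r) = 1 := by
  rw [← oneSubPow_add, add_neg_cancel]
  simp [oneSubPow]

theorem coeff_mul_expand {R : Type*} [CommRing R] {p : ℕ} (hp : p ≠ 0) (f g : PowerSeries R)
    (n : ℕ) :
    PowerSeries.coeff n (f * PowerSeries.expand p hp g) =
      ∑ j ∈ Finset.range (n / p + 1), PowerSeries.coeff j g * PowerSeries.coeff (n - p * j) f := by
  rw [mul_comm, PowerSeries.coeff_mul]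
  symm
  refine Finset.sum_of_injOn (fun j => (p * j, n - p * j)) ?_ ?_ ?_ ?_
  · intro a _ b _ hab
    simpa [hp] using congrArg Prod.fst hab
  · intro j hj
    rw [Finset.mem_coe, Finset.mem_range, Nat.lt_succ_iff,
      Nat.le_div_iff_mul_le (Nat.pos_of_ne_zero hp)] at hj
    rw [Finset.mem_coe, Finset.HasAntidiagonal.mem_antidiagonal]
    dsimp only
    rw [mul_comm] at hj
    omega
  · intro x hx hx'
    rw [Finset.HasAntidiagonal.mem_antidiagonal] at hx
    rw [PowerSeries.coeff_expand, if_neg, zero_mul]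
    rintro ⟨j, hj⟩
    refine hx' ⟨j, ?_, ?_⟩
    · rw [Finset.mem_coe, Finset.mem_range, Nat.lt_succ_iff,
        Nat.le_div_iff_mul_le (Nat.pos_of_ne_zero hp), mul_comm]
      omega
    · ext
      · exact hj.symm
      · dsimp only
        omega
  · intro j _
    rw [PowerSeries.coeff_expand_mul]

/-- Explains the separate case `b = 0` of `A` and `B`: there only the term with `p * j = n`
survives. -/
theorem sum_range_ite_eq_mul {p : ℕ} (hp : p ≠ 0) (n : ℕ) (f : ℕ → ℚ) :
    (∑ j ∈ Finset.range (n / p + 1), if n - p * j = 0 then f j else 0) =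
      if p ∣ n then f (n / p) else 0 := by
  have hle : ∀ j ∈ Finset.range (n / p + 1), p * j ≤ n := by
    intro j hj
    rw [Finset.mem_range, Nat.lt_succ_iff, Nat.le_div_iff_mul_le (Nat.pos_of_ne_zero hp)] at hj
    rwa [mul_comm]
  split_ifs with h
  · obtain ⟨k, rfl⟩ := h
    rw [Nat.mul_div_cancel_left _ (Nat.pos_of_ne_zero hp)] at hle ⊢
    rw [Finset.sum_eq_single k]
    · simp
    · intro j hj hjk
      rw [if_neg]
      intro h0
      have := hle j hj
      exact hjk (Nat.eq_of_mul_eq_mul_left (Nat.pos_of_ne_zero hp) (by omega))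
    · simp
  · refine Finset.sum_eq_zero fun j hj => if_neg fun h0 => h ⟨j, ?_⟩
    have := hle j hj
    omega

theorem coeff_oneSubPow_mul_expand {p : ℕ} (hp : p ≠ 0) (q n : ℕ) (a b : ℚ) :
    PowerSeries.coeff n (oneSubPow b * PowerSeries.expand p hp (oneSubPow (a * q / p))) =
      A p q n a b * (-1) ^ n := by
  rw [coeff_mul_expand]
  simp_rw [coeff_oneSubPow]
  have hsum : ∑ j ∈ Finset.range (n / p + 1), (-1) ^ j * Ring.choose (a * q / p) j *
      ((-1) ^ (n - p * j) * Ring.choose b (n - p * j)) =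
      (∑ j ∈ Finset.range (n / p + 1),
        Ring.choose (a * q / p) j * Ring.choose b (n - p * j) * (-1) ^ (j + p * j)) * (-1) ^ n := by
    rw [Finset.sum_mul]
    refine Finset.sum_congr rfl fun j hj => ?_
    rw [Finset.mem_range, Nat.lt_succ_iff, Nat.le_div_iff_mul_le (Nat.pos_of_ne_zero hp),
      mul_comm] at hj
    obtain ⟨k, rfl⟩ := Nat.exists_eq_add_of_le hj
    rw [Nat.add_sub_cancel_left, pow_add, pow_add]
    have : ((-1 : ℚ) ^ (p * j)) * (-1) ^ (p * j) = 1 := by rw [← mul_pow]; simp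
    linear_combination (-(-1) ^ j * (-1) ^ k * Ring.choose (a * q / p) j * Ring.choose b k) * this
  rw [hsum, A]
  split_ifs with hb hpn
  · subst hb
    congr 1
    have := sum_range_ite_eq_mul hp n
      fun j => Ring.choose (a * q / p) j * (-1) ^ (j + p * j)
    rw [if_pos hpn, Nat.mul_div_cancel' hpn, add_comm (n / p) n] at this
    refine Eq.trans ?_ this
    refine Finset.sum_congr rfl fun j _ => ?_
    rw [Ring.choose_zero_ite]
    split_ifs <;> simp
  · subst hb
    rw [zero_mul, mul_eq_zero]
    left
    have := sum_range_ite_eq_mul hp n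
      fun j => Ring.choose (a * q / p) j * (-1) ^ (j + p * j)
    rw [if_neg hpn] at this
    refine Eq.trans ?_ this
    refine Finset.sum_congr rfl fun j _ => ?_
    rw [Ring.choose_zero_ite]
    split_ifs <;> simp
  · rfl

theorem coeff_oneSubPow_neg_mul_expand {p : ℕ} (hp : p ≠ 0) (q n : ℕ) (a b : ℚ) :
    PowerSeries.coeff n (oneSubPow (-b) * PowerSeries.expand p hp (oneSubPow (-(a * q / p)))) =
      B p q n a b := by
  rw [coeff_mul_expand]
  simp_rw [coeff_oneSubPow_neg]
  rw [B]
  split_ifs with hb hpn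
  · subst hb
    have := sum_range_ite_eq_mul hp n fun j => Ring.choose (a * q / p + j - 1) j
    rw [if_pos hpn] at this
    refine Eq.trans ?_ this
    refine Finset.sum_congr rfl fun j _ => ?_
    rw [← coeff_oneSubPow_neg 0, neg_zero, coeff_oneSubPow, Ring.choose_zero_ite]
    split_ifs with h0
    · simp [h0]
    · simp
  · subst hb
    have := sum_range_ite_eq_mul hp n fun j => Ring.choose (a * q / p + j - 1) j
    rw [if_neg hpn] at this
    refine Eq.trans ?_ this
    refine Finset.sum_congr rfl fun j _ => ?_
    rw [← coeff_oneSubPow_neg 0, neg_zero, coeff_oneSubPow, Ring.choose_zero_ite]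
    split_ifs with h0
    · simp [h0]
    · simp
  · rfl

end OneSubPow

/-! ### Product over the values of a nontrivial character -/

section Character

open scoped Classical

variable {F : Type*} [Field F] [Fintype F]

/-- The values of `ψ` are all the `p`-th roots of unity, each taken equally often, and `∏ (1 - ζ X)
= 1 - X ^ p`. -/
theorem prod_one_sub_addChar {p : ℕ} [CharP F p] (hp : p ≠ 0) {ψ : AddChar F ℂ} (hψ : ψ ≠ 1) :
    ∏ c : F, (1 - PowerSeries.C (ψ c) * PowerSeries.X) =
      PowerSeries.expand p hp ((1 - PowerSeries.X) ^ (Fintype.card F / p)) := by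
  have hpp : p.Prime := CharP.char_is_prime F p
  have : Fact p.Prime := ⟨hpp⟩
  have hpow : ∀ c, ψ c ^ p = 1 := by
    intro c
    rw [← AddChar.map_nsmul_eq_pow, nsmul_eq_mul, CharP.cast_eq_zero, zero_mul,
      AddChar.map_zero_eq_one]
  obtain ⟨c₀, hc₀⟩ := (AddChar.ne_one_iff).1 hψ
  have hprim : IsPrimitiveRoot (ψ c₀) p := by
    rw [← orderOf_eq_prime (hpow c₀) hc₀]
    exact IsPrimitiveRoot.orderOf _
  have hmem : ∀ c, ψ c ∈ nthRootsFinset p (1 : ℂ) := fun c =>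
    (mem_nthRootsFinset hpp.pos 1).2 (hpow c)
  have hsurj : ∀ ζ ∈ nthRootsFinset p (1 : ℂ), ∃ c, ψ c = ζ := by
    intro ζ hζ
    have : NeZero p := ⟨hp⟩
    obtain ⟨k, -, hk⟩ := hprim.eq_pow_of_pow_eq_one ((mem_nthRootsFinset hpp.pos 1).1 hζ)
    exact ⟨k • c₀, by rw [AddChar.map_nsmul_eq_pow, hk]⟩
  have hfib : ∀ ζ ∈ nthRootsFinset p (1 : ℂ),
      (Finset.univ.filter fun c => ψ c = ζ).card = (Finset.univ.filter fun c => ψ c = 1).card := by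
    intro ζ hζ
    obtain ⟨c, rfl⟩ := hsurj ζ hζ
    refine Finset.card_nbij' (fun x => x - c) (fun x => x + c) ?_ ?_ ?_ ?_
    · intro x hx
      simp only [Finset.coe_filter, Finset.mem_univ, true_and, Set.mem_ofPred_eq] at hx ⊢
      rw [AddChar.map_sub_eq_div, hx, div_self (ψ.val_isUnit c).ne_zero]
    · intro x hx
      simp only [Finset.coe_filter, Finset.mem_univ, true_and, Set.mem_ofPred_eq] at hx ⊢
      rw [AddChar.map_add_eq_mul, hx, one_mul]
    · intro x _
      simp
    · intro x _
      simp
  have hcard : Fintype.card F = p * (Finset.univ.filter fun c => ψ c = 1).card := by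
    rw [← Finset.card_univ, Finset.card_eq_sum_card_fiberwise (f := ψ)
      (t := nthRootsFinset p (1 : ℂ)) fun c _ => hmem c, Finset.sum_congr rfl hfib,
      Finset.sum_const, hprim.card_nthRootsFinset, smul_eq_mul]
  rw [hcard, Nat.mul_div_cancel_left _ hpp.pos,
    ← Finset.prod_fiberwise_of_maps_to (t := nthRootsFinset p (1 : ℂ)) (g := ψ) fun c _ => hmem c]
  have h1 : ∀ ζ ∈ nthRootsFinset p (1 : ℂ),
      ∏ c ∈ Finset.univ.filter (fun c => ψ c = ζ), (1 - PowerSeries.C (ψ c) * PowerSeries.X) =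
      (1 - PowerSeries.C ζ * PowerSeries.X) ^ (Finset.univ.filter fun c => ψ c = 1).card := by
    intro ζ hζ
    rw [← hfib ζ hζ, ← Finset.prod_const]
    refine Finset.prod_congr rfl fun c hc => ?_
    rw [(Finset.mem_filter.1 hc).2]
  rw [Finset.prod_congr rfl h1, Finset.prod_pow, map_pow]
  congr 1
  have h2 : (∏ ζ ∈ nthRootsFinset p (1 : ℂ), (1 - C ζ * X) : ℂ[X]) = 1 - X ^ p := by
    -- The factorization of `1 ^ p - X ^ p` is taken over the roots of unity of `ℂ[X]`, which are
    -- constants.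
    have hC : IsPrimitiveRoot (C (ψ c₀)) p := hprim.map_of_injective C_injective
    have := hC.pow_sub_pow_eq_prod_sub_mul (1 : ℂ[X]) X hpp.pos
    rw [one_pow] at this
    rw [this]
    refine Finset.prod_bij (fun ζ _ => C ζ) ?_ ?_ ?_ ?_
    · intro ζ hζ
      rw [mem_nthRootsFinset hpp.pos] at hζ ⊢
      rw [← C_pow, hζ, C_1]
    · intro a _ b _ hab
      exact C_injective hab
    · intro b hb
      rw [mem_nthRootsFinset hpp.pos] at hb
      have : NeZero p := ⟨hp⟩
      obtain ⟨k, -, hk⟩ := hC.eq_pow_of_pow_eq_one hb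
      refine ⟨ψ c₀ ^ k, ?_, by rw [C_pow, hk]⟩
      rw [mem_nthRootsFinset hpp.pos, ← pow_mul, mul_comm, pow_mul, hpow, one_pow]
    · intros
      rfl
  have h3 := congrArg (Polynomial.coeToPowerSeries.ringHom (R := ℂ)) h2
  rw [map_prod] at h3
  simpa using h3

end Character

/-! ### The full series for the trivial and nontrivial weights -/

section LSeries

open scoped Classical

variable {F : Type*} [Field F]

theorem isWeight_one : IsWeight fun _ : F[X] => (1 : ℚ) :=
  ⟨fun _ _ _ _ => (mul_one 1).symm⟩

theorem isWeight_addChar (ψ : AddChar F ℂ) : IsWeight fun g : F[X] => ψ g.nextCoeff :=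
  ⟨fun f g hf hg => by rw [hf.nextCoeff_mul hg, AddChar.map_add_eq_mul]⟩

variable [Finite F]

theorem coeff_genSeries_one (n : ℕ) :
    PowerSeries.coeff n (genSeries (fun _ : F[X] => (1 : ℚ)) fun _ => True) =
      (Nat.card F : ℚ) ^ n := by
  rw [coeff_genSeries, Finset.filter_true]
  simp [card_monics]

/-- In positive degree, translating the next coefficient by `c` with `ψ c ≠ 1` permutes the monics
and multiplies the sum by `ψ c`, so the sum vanishes. -/
theorem coeff_genSeries_addChar {ψ : AddChar F ℂ} (hψ : ψ ≠ 1) (n : ℕ) :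
    PowerSeries.coeff n (genSeries (fun g : F[X] => ψ g.nextCoeff) fun _ => True) =
      if n = 0 then 1 else 0 := by
  rw [coeff_genSeries, Finset.filter_true]
  rcases n with _ | n
  · have : monics F 0 = {1} := by
      ext g
      rw [mem_monics, Finset.mem_singleton]
      constructor
      · rintro ⟨hg, hd⟩
        exact eq_one_of_monic_natDegree_zero hg hd
      · rintro rfl
        exact ⟨monic_one, natDegree_one⟩
    rw [this, Finset.sum_singleton, ← C_1, nextCoeff_C_eq_zero, AddChar.map_zero_eq_one, if_pos rfl]
  · rw [if_neg n.succ_ne_zero]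
    obtain ⟨c, hc⟩ := AddChar.ne_one_iff.1 hψ
    have hshift : ∀ (g : F[X]) (b : F), g ∈ monics F (n + 1) →
        g + C b * X ^ n ∈ monics F (n + 1) := by
      intro g b hg
      rw [mem_monics] at hg ⊢
      have hdeg : (C b * X ^ n).degree < g.degree := by
        rw [degree_eq_natDegree hg.1.ne_zero, hg.2]
        exact (degree_C_mul_X_pow_le n b).trans_lt (by exact_mod_cast n.lt_succ_self)
      exact ⟨hg.1.add_of_left hdeg, by rw [natDegree_add_eq_left_of_degree_lt hdeg, hg.2]⟩
    have hnext : ∀ g ∈ monics F (n + 1), (g + C c * X ^ n).nextCoeff = g.nextCoeff + c := by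
      intro g hg
      have h1 := (mem_monics.1 hg).2
      have h2 := (mem_monics.1 (hshift g c hg)).2
      rw [nextCoeff_of_natDegree_pos (by omega), nextCoeff_of_natDegree_pos (by omega), h1, h2]
      simp
    have hsum : ∑ g ∈ monics F (n + 1), ψ g.nextCoeff =
        (∑ g ∈ monics F (n + 1), ψ g.nextCoeff) * ψ c := by
      rw [Finset.sum_mul]
      symm
      refine Finset.sum_bij' (fun g _ => g + C c * X ^ n) (fun g _ => g + C (-c) * X ^ n)
        (fun g hg => hshift g c hg) (fun g hg => hshift g (-c) hg) ?_ ?_ ?_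
      · intro g _
        rw [C_neg]
        ring
      · intro g _
        rw [C_neg]
        ring
      · intro g hg
        rw [hnext g hg, AddChar.map_add_eq_mul]
    have h0 : (∑ g ∈ monics F (n + 1), ψ g.nextCoeff) * (ψ c - 1) = 0 := by
      rw [mul_sub, mul_one, ← hsum, sub_self]
    exact (mul_eq_zero.1 h0).resolve_right (sub_ne_zero.2 hc)

end LSeries

/-! ### Local products over `irrs F i` -/

section EulerFactor

open scoped Classical

theorem prod_mk_pow_mul_prod_one_sub {R ι : Type*} [CommRing R] (S : Finset ι) (w : ι → R) :
    (∏ h ∈ S, PowerSeries.mk fun k => w h ^ k) *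
      ∏ h ∈ S, (1 - PowerSeries.C (w h) * PowerSeries.X) = 1 := by
  rw [← Finset.prod_mul_distrib]
  refine Finset.prod_eq_one fun h _ => ?_
  ext k
  rw [mul_sub, mul_one, map_sub, mul_left_comm, PowerSeries.coeff_C_mul]
  rcases k with _ | k
  · simp
  · simp [PowerSeries.coeff_one, PowerSeries.coeff_succ_mul_X, pow_succ']

variable {F : Type*} [Field F] [Fintype F]

theorem prod_irrs_one_sub_one (i : ℕ) :
    ∏ _h ∈ irrs F i, (1 - PowerSeries.C (1 : ℚ) * PowerSeries.X) =
      oneSubPow ((irrs F i).card : ℚ) := by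
  rw [oneSubPow_natCast, Finset.prod_const, map_one, one_mul]

theorem prod_irrs_mk_one (i : ℕ) :
    ∏ _h ∈ irrs F i, (PowerSeries.mk fun k => (1 : ℚ) ^ k) =
      oneSubPow (-((irrs F i).card : ℚ)) := by
  have h1 := prod_mk_pow_mul_prod_one_sub (irrs F i) fun _ => (1 : ℚ)
  rw [prod_irrs_one_sub_one] at h1
  exact left_inv_eq_right_inv h1 (oneSubPow_mul_neg _)

theorem coeff_prod_irrs_mk_one (i l : ℕ) :
    PowerSeries.coeff l (∏ _h ∈ irrs F i, (PowerSeries.mk fun k => (1 : ℚ) ^ k)) =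
      (((irrs F i).card + l - 1).choose l : ℚ) := by
  rw [prod_irrs_mk_one, coeff_oneSubPow_neg]
  -- For `l = 0` the natural subtraction may truncate, but both binomials are `1`.
  rcases Nat.eq_zero_or_pos l with rfl | hl
  · simp
  · rw [← Nat.cast_add, ← Nat.cast_pred (by omega), Ring.choose_natCast]

variable {p q : ℕ} [CharP F p]

theorem prod_irrs_one_sub_addChar (hp : p ≠ 0) (hq : Fintype.card F = q) {ψ : AddChar F ℂ}
    (hψ : ψ ≠ 1) {i : ℕ} (hi : 0 < i) :
    ∏ h ∈ irrs F i, (1 - PowerSeries.C (ψ h.nextCoeff) * PowerSeries.X) =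
      PowerSeries.map (algebraMap ℚ ℂ) (oneSubPow (bCoef p q i) *
        PowerSeries.expand p hp (oneSubPow (aCoef p q i * q / p))) := by
  have hq' : Nat.card F = q := by rw [← hq, Fintype.card_eq_nat_card]
  set N : F → ℕ := fun c => ((irrs F i).filter fun h => h.nextCoeff = c).card with hN
  have ha : ∀ c, c ≠ 0 → N c = N 1 := fun c hc => by
    have h1 := card_irrs_nextCoeff_of_ne_zero (p := p) hq' hi hc
    have h2 := card_irrs_nextCoeff_of_ne_zero (p := p) hq' hi (one_ne_zero (α := F))
    exact_mod_cast h1.trans h2.symm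
  have ha1 : (N 1 : ℚ) = aCoef p q i := card_irrs_nextCoeff_of_ne_zero hq' hi one_ne_zero
  have h0 : (N 0 : ℚ) = aCoef p q i + bCoef p q i := card_irrs_nextCoeff_zero hq' hi
  have hdvd : p ∣ q := by
    rw [← hq, ← CharP.cast_eq_zero_iff F p, FiniteField.cast_card_eq_zero]
  have hprod : ∏ h ∈ irrs F i, (1 - PowerSeries.C (ψ h.nextCoeff) * PowerSeries.X) =
      ∏ c : F, (1 - PowerSeries.C (ψ c) * PowerSeries.X) ^ N c := by
    rw [← Finset.prod_fiberwise_of_maps_to (t := Finset.univ) (g := nextCoeff)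
      fun _ _ => Finset.mem_univ _]
    refine Finset.prod_congr rfl fun c _ => ?_
    rw [hN, ← Finset.prod_const]
    refine Finset.prod_congr rfl fun h hh => ?_
    rw [(Finset.mem_filter.1 hh).2]
  -- Since `b_i = N 0 - N 1` may be negative, the identity is multiplied by `(1 - X) ^ N 1`: all
  -- values `c`, including `0`, then occur `N 1` times, and `N 0` factors `1 - X` are left over.
  have hmul : (∏ h ∈ irrs F i, (1 - PowerSeries.C (ψ h.nextCoeff) * PowerSeries.X)) *
      (1 - PowerSeries.X) ^ N 1 =
      (1 - PowerSeries.X) ^ N 0 *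
        PowerSeries.expand p hp ((1 - PowerSeries.X) ^ (q / p)) ^ N 1 := by
    rw [hprod, ← hq, ← prod_one_sub_addChar hp hψ, ← Finset.prod_pow,
      ← Finset.mul_prod_erase _ _ (Finset.mem_univ 0),
      ← Finset.mul_prod_erase (a := 0) _ (fun c => (1 - PowerSeries.C (ψ c) * PowerSeries.X) ^ N 1)
        (Finset.mem_univ 0),
      Finset.prod_congr rfl fun c hc => by rw [ha c (Finset.ne_of_mem_erase hc)],
      AddChar.map_zero_eq_one, map_one, one_mul]
    ring
  have hmap : ∀ n : ℕ, PowerSeries.map (algebraMap ℚ ℂ) (oneSubPow n) =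
      (1 - PowerSeries.X) ^ n := by
    intro n
    simp [oneSubPow_natCast]
  have hexp : aCoef p q i * q / p = ((q / p * N 1 : ℕ) : ℚ) := by
    have : (p : ℚ) ≠ 0 := by exact_mod_cast hp
    rw [← ha1, Nat.cast_mul, Nat.cast_div hdvd this]
    ring
  have hmul' : PowerSeries.map (algebraMap ℚ ℂ) (oneSubPow (bCoef p q i) *
        PowerSeries.expand p hp (oneSubPow (aCoef p q i * q / p))) *
      (1 - PowerSeries.X) ^ N 1 =
      (1 - PowerSeries.X) ^ N 0 *
        PowerSeries.expand p hp ((1 - PowerSeries.X) ^ (q / p)) ^ N 1 := by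
    rw [← hmap, ← hmap, h0, ha1, oneSubPow_add, hexp, map_mul, map_mul, PowerSeries.map_expand,
      hmap, pow_mul, map_pow]
    ring
  refine mul_right_cancel₀ (b := (1 - PowerSeries.X : PowerSeries ℂ) ^ N 1) (pow_ne_zero _ ?_)
    (hmul.trans hmul'.symm)
  intro h
  simpa using congrArg PowerSeries.constantCoeff h

theorem prod_irrs_mk_addChar (hp : p ≠ 0) (hq : Fintype.card F = q) {ψ : AddChar F ℂ}
    (hψ : ψ ≠ 1) {i : ℕ} (hi : 0 < i) :
    ∏ h ∈ irrs F i, (PowerSeries.mk fun k => ψ h.nextCoeff ^ k) =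
      PowerSeries.map (algebraMap ℚ ℂ) (oneSubPow (-bCoef p q i) *
        PowerSeries.expand p hp (oneSubPow (-(aCoef p q i * q / p)))) := by
  have h1 := prod_mk_pow_mul_prod_one_sub (irrs F i) fun h : F[X] => ψ h.nextCoeff
  rw [prod_irrs_one_sub_addChar hp hq hψ hi] at h1
  refine left_inv_eq_right_inv h1 ?_
  rw [← map_mul, mul_mul_mul_comm, oneSubPow_mul_neg, ← map_mul, oneSubPow_mul_neg]
  simp

/-- Up to sign, `A` is a coefficient of a product of `card` linear factors. This makes the sum over
all tuples `k` finite. -/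
theorem A_eq_zero_of_card_lt (hq : Fintype.card F = q) {i k : ℕ}
    (hi : 0 < i) (hk : (irrs F i).card < k) : A p q k (aCoef p q i) (bCoef p q i) = 0 := by
  have hp : p ≠ 0 := (CharP.char_is_prime F p).ne_zero
  have hψ := AddChar.FiniteField.primitiveChar_to_Complex_isPrimitive F
  have h1 : AddChar.FiniteField.primitiveChar_to_Complex F ≠ 1 := by
    have := hψ one_ne_zero
    rwa [AddChar.mulShift_one] at this
  have h2 := congrArg (PowerSeries.coeff k) (prod_irrs_one_sub_addChar (p := p) hp hq h1 hi)
  rw [coeff_prod_one_sub_of_card_lt hk, PowerSeries.coeff_map, coeff_oneSubPow_mul_expand] at h2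
  have h3 := (map_eq_zero (algebraMap ℚ ℂ)).1 h2.symm
  exact (mul_eq_zero.1 h3).resolve_right (pow_ne_zero _ (by norm_num))

end EulerFactor

/-! ### Orthogonality and the two contributions -/

section Counting

open scoped Classical

variable {F : Type*} [Field F]

theorem bracket_one_eq_iff {f g : F[X]} (hf : f.Monic) (hg : g.Monic) :
    bracket 1 f = bracket 1 g ↔ f.nextCoeff = g.nextCoeff := by
  rw [bracket, bracket, Ideal.Quotient.eq, Ideal.mem_span_singleton, X_pow_dvd_iff]
  constructor
  · intro h
    have := h 1 (by norm_num)
    rwa [coeff_sub, coeff_one_reverse, coeff_one_reverse, sub_eq_zero] at this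
  · intro h d hd
    have : d = 0 ∨ d = 1 := by omega
    rcases this with rfl | rfl
    · rw [coeff_sub, coeff_zero_reverse, coeff_zero_reverse, hf.leadingCoeff, hg.leadingCoeff,
        sub_self]
    · rw [coeff_sub, coeff_one_reverse, coeff_one_reverse, h, sub_self]

variable [Fintype F]

theorem NStar_eq_card (m : ℕ) (T : Finset ℕ) (l : ℕ → ℕ) (α : F) :
    NStar 1 m T l (X + C α) =
      ((monics F m).filter fun g => (∀ i ∈ T, factorCount i g = l i) ∧ g.nextCoeff = α).card := by
  rw [NStar, ← Set.ncard_coe_finset]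
  congr 1
  ext g
  simp only [Set.mem_ofPred_eq, Finset.coe_filter, mem_monics, and_assoc]
  refine and_congr_right fun hg => and_congr_right fun _ => ?_
  rw [bracket_one_eq_iff hg (monic_X_add_C α), nextCoeff_X_add_C, and_comm]

theorem card_mul_NStar (m : ℕ) (T : Finset ℕ) (l : ℕ → ℕ) (α : F) {ψ : AddChar F ℂ}
    (hψ : ψ.IsPrimitive) :
    (Fintype.card F : ℂ) * NStar 1 m T l (X + C α) =
      ∑ a : F, ψ (-(a * α)) * PowerSeries.coeff m
        (genSeries (fun g : F[X] => ψ.mulShift a g.nextCoeff)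
          fun g => ∀ i ∈ T, factorCount i g = l i) := by
  simp_rw [coeff_genSeries, Finset.mul_sum]
  rw [Finset.sum_comm, NStar_eq_card, ← Finset.filter_filter, Finset.card_filter, Nat.cast_sum,
    Finset.mul_sum]
  refine Finset.sum_congr (by congr!) fun g _ => ?_
  have h : ∀ a : F, ψ (-(a * α)) * ψ.mulShift a g.nextCoeff = ψ (a * (g.nextCoeff - α)) := by
    intro a
    rw [AddChar.mulShift_apply, ← AddChar.map_add_eq_mul]
    congr 1
    ring
  simp_rw [h]
  rw [AddChar.sum_mulShift _ hψ]
  simp [sub_eq_zero]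

theorem coeff_genSeries_factorCount_one {q : ℕ} (hq : Fintype.card F = q) (T : Finset ℕ)
    (l : ℕ → ℕ) (m : ℕ) :
    PowerSeries.coeff m
        (genSeries (fun _ : F[X] => (1 : ℚ)) fun g => ∀ i ∈ T, factorCount i g = l i) =
      (q : ℚ) ^ m *
        (∏ i ∈ T, (((irr F i).ncard + l i - 1).choose (l i) : ℚ) * ((q : ℚ) ^ (i * l i))⁻¹) *
        (∑ j ∈ Fintype.piFinset (fun i : T => Finset.range ((irr F i).ncard + 1)),
          if ∑ i : T, (i : ℕ) * (l i + j i) ≤ m then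
            ∏ i : T, ((irr F i).ncard.choose (j i) : ℚ) * (-1) ^ j i *
              ((q : ℚ) ^ ((i : ℕ) * j i))⁻¹
          else 0) := by
  have hq0 : (q : ℚ) ≠ 0 := by
    rw [← hq]
    exact_mod_cast Fintype.card_ne_zero
  rw [coeff_genSeries_factorCount isWeight_one]
  simp_rw [ncard_irr, coeff_prod_irrs_mk_one, prod_irrs_one_sub_one, coeff_oneSubPow,
    Ring.choose_natCast, coeff_genSeries_one, ← Fintype.card_eq_nat_card, hq]
  rw [Finset.prod_mul_distrib, mul_left_comm ((q : ℚ) ^ m), mul_assoc]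
  refine congrArg _ ?_
  rw [Finset.mul_sum]
  refine Finset.sum_congr rfl fun j _ => ?_
  split_ifs with h
  · obtain ⟨r, hr⟩ := Nat.exists_eq_add_of_le h
    rw [hr, Nat.add_sub_cancel_left, ← Finset.prod_coe_sort T fun i => ((q : ℚ) ^ (i * l i))⁻¹]
    simp only [Finset.prod_mul_distrib, Finset.prod_inv_distrib, Finset.prod_pow_eq_pow_sum,
      mul_add, Finset.sum_add_distrib, pow_add]
    field_simp
  · simp

theorem coeff_genSeries_factorCount_addChar {p q : ℕ} [CharP F p] (hq : Fintype.card F = q)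
    {ψ : AddChar F ℂ} (hψ : ψ ≠ 1) (T : Finset ℕ) (hT : ∀ i ∈ T, 0 < i) (l : ℕ → ℕ) (m : ℕ) :
    PowerSeries.coeff m
        (genSeries (fun g : F[X] => ψ g.nextCoeff) fun g => ∀ i ∈ T, factorCount i g = l i) =
      algebraMap ℚ ℂ ((∏ i ∈ T, B p q (l i) (aCoef p q i) (bCoef p q i)) *
        (∑ᶠ k : T → ℕ,
          if ∑ i : T, (i : ℕ) * (l i + k i) = m then
            ∏ i : T, A p q (k i) (aCoef p q i) (bCoef p q i) * (-1) ^ k i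
          else 0)) := by
  have hp : p ≠ 0 := (CharP.char_is_prime F p).ne_zero
  rw [coeff_genSeries_factorCount (isWeight_addChar ψ), finsum_eq_sum_of_support_subset
    (s := Fintype.piFinset fun i : T => Finset.range ((irrs F i).card + 1))]
  · rw [map_mul, map_prod, map_sum]
    congr 1
    · refine Finset.prod_congr rfl fun i hi => ?_
      rw [prod_irrs_mk_addChar (p := p) hp hq hψ (hT i hi), PowerSeries.coeff_map,
        coeff_oneSubPow_neg_mul_expand]
    · refine Finset.sum_congr rfl fun k _ => ?_
      rw [coeff_genSeries_addChar hψ, apply_ite (algebraMap ℚ ℂ), map_zero, map_prod,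
        Finset.prod_congr rfl fun (i : T) _ => by
          rw [prod_irrs_one_sub_addChar (p := p) hp hq hψ (hT i i.2), PowerSeries.coeff_map,
            coeff_oneSubPow_mul_expand]]
      -- The full series is `1`, so of the terms of degree at most `m` only those of degree exactly
      -- `m` survive.
      by_cases h : ∑ i : T, (i : ℕ) * (l i + k i) = m
      · rw [if_pos h, if_pos h.le, h, Nat.sub_self, if_pos rfl, mul_one]
      · rw [if_neg h]
        split_ifs with h1 h2
        · omega
        · rw [mul_zero]
        · rfl
  · intro k hk
    rw [Finset.mem_coe, Fintype.mem_piFinset]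
    by_contra hcon
    push Not at hcon
    obtain ⟨i, hi⟩ := hcon
    rw [Finset.mem_range, not_lt, Nat.succ_le_iff] at hi
    refine hk ?_
    dsimp only
    rw [ite_eq_right_iff]
    intro _
    refine Finset.prod_eq_zero (Finset.mem_univ i) ?_
    rw [A_eq_zero_of_card_lt hq (hT i i.2) hi, zero_mul]

end Counting


end

end PrescribedFactorization

/-! ### The formula -/

open Polynomial PrescribedFactorization in
theorem theorem7p6 {F : Type*} [Field F] [Fintype F] (p : ℕ) [CharP F p]
    (q : ℕ) (hq : Fintype.card F = q)
    (T : Finset ℕ) (hT : ∀ i ∈ T, 0 < i) (l : ℕ → ℕ) (m : ℕ) (α : F) :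
    (NStar 1 m T l (X + C α) : ℚ) =
      (q : ℚ) ^ ((m : ℤ) - 1) *
        (∏ i ∈ T, (((irr F i).ncard + l i - 1).choose (l i) : ℚ) * ((q : ℚ) ^ (i * l i))⁻¹) *
        (∑ j ∈ Fintype.piFinset (fun i : T => Finset.range ((irr F i).ncard + 1)),
          if ∑ i : T, (i : ℕ) * (l i + j i) ≤ m then
            ∏ i : T, ((irr F i).ncard.choose (j i) : ℚ) * (-1) ^ j i * ((q : ℚ) ^ ((i : ℕ) * j i))⁻¹
          else 0)
      + v q α / q *
        (∏ i ∈ T, B p q (l i) (aCoef p q i) (bCoef p q i)) *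
        (∑ᶠ k : T → ℕ,
          if ∑ i : T, (i : ℕ) * (l i + k i) = m then
            ∏ i : T, A p q (k i) (aCoef p q i) (bCoef p q i) * (-1) ^ k i
          else 0) := by 
  have hq0 : (q : ℚ) ≠ 0 := by
    rw [← hq]
    exact_mod_cast Fintype.card_ne_zero
  set V : ℚ := (∏ i ∈ T, B p q (l i) (aCoef p q i) (bCoef p q i)) *
    (∑ᶠ k : T → ℕ, if ∑ i : T, (i : ℕ) * (l i + k i) = m then
      ∏ i : T, A p q (k i) (aCoef p q i) (bCoef p q i) * (-1) ^ k i else 0) with hV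
  have hψ := AddChar.FiniteField.primitiveChar_to_Complex_isPrimitive F
  set ψ := AddChar.FiniteField.primitiveChar_to_Complex F
  have h1 := card_mul_NStar m T l α hψ
  have h2 := coeff_genSeries_factorCount_one hq T l m
  set U : ℚ := PowerSeries.coeff m
    (genSeries (fun _ : F[X] => (1 : ℚ)) fun g => ∀ i ∈ T, factorCount i g = l i) with hU
  classical
  have h3 : PowerSeries.coeff m (genSeries (fun g : F[X] => ψ.mulShift 0 g.nextCoeff)
      fun g => ∀ i ∈ T, factorCount i g = l i) = (U : ℂ) := by
    rw [hU, coeff_genSeries, coeff_genSeries]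
    simp
  -- Every nontrivial character yields the same rational `V`.
  have h4 : ∀ a ∈ Finset.univ.erase (0 : F), ψ (-(a * α)) * PowerSeries.coeff m
      (genSeries (fun g : F[X] => ψ.mulShift a g.nextCoeff)
        fun g => ∀ i ∈ T, factorCount i g = l i) = ψ (a * -α) * (V : ℂ) := by
    intro a ha
    rw [coeff_genSeries_factorCount_addChar (p := p) hq (hψ (Finset.ne_of_mem_erase ha)) T hT,
      mul_neg]
    rfl
  -- The full character sum is `q` or `0` according to whether `α = 0`; removing the term `a = 0`
  -- subtracts `1`.
  have h5 : ∑ a ∈ Finset.univ.erase (0 : F), ψ (a * -α) = (v q α : ℂ) := by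
    have := AddChar.sum_mulShift (-α) hψ
    rw [← Finset.add_sum_erase _ _ (Finset.mem_univ 0), zero_mul, AddChar.map_zero_eq_one, hq]
      at this
    rw [v, eq_sub_of_add_eq' this]
    by_cases hα : α = 0 <;> simp [hα]
  rw [← Finset.add_sum_erase _ _ (Finset.mem_univ 0), Finset.sum_congr rfl h4, ← Finset.sum_mul,
    h5, h3, zero_mul, neg_zero, AddChar.map_zero_eq_one, one_mul, hq] at h1
  have h6 : (q : ℚ) * NStar 1 m T l (X + C α) = U + v q α * V := by exact_mod_cast h1
  rw [mul_assoc (v q α / q), ← hV, zpow_sub_one₀ hq0, zpow_natCast]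
  rw [h2] at h6
  refine mul_left_cancel₀ hq0 (h6.trans ?_)
  field_simp
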